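/- Let $n\ge 1$ and $\lambda>0$, and let $F_X$ be a probability distribution on $(0,\infty)$. In the $(n,1)$ fork-join system, jobs arrive according to a Poisson process of rate $\lambda$ to a system of $n$ servers that is initially empty. Each job is forked into $n$ tasks, one for each server, which join first-come first-serve queues at the servers. As soon as any one task of a job is served, all its remaining tasks are canceled and leave their queues immediately. The service times of the tasks are i.i.d. with distribution $F_X$ across jobs and servers, and independent of the arrivals. The latency $T_k$ of the $k$-th job is the time from its arrival until one of its tasks is served. Its cost $C_k$ is the total time that the $n$ servers spend serving its tasks (a task that is canceled before it reaches the head of its queue contributes $0$). Let $X_{1:n}=\min(X_1,\dots,X_n)$ with $X_1,\dots,X_n$ i.i.d. of distribution $F_X$. Expectations take values in $[0,\infty]$. Latency. Suppose that $\lambda\,\mathbb E[X_{1:n}]<1$. Consider also an initially empty M/G/1 queue (a single first-come first-serve server) with Poisson arrivals of rate $\lambda$ and i.i.d. service times distributed as $X_{1:n}$, independent of the arrivals, and let $T_k^{M/G/1}$ be the latency (waiting plus service time) of its $k$-th job. Then $T_k$ and $T_k^{M/G/1}$ converge in distribution, as $k\to\infty$, to the same steady-state law, that is, to a common limit $T$,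 and $$\lim_{k\to\infty}\mathbb E[T_k]=\lim_{k\to\infty}\mathbb E[T_k^{M/G/1}]=\mathbb E[T]=\mathbb E[X_{1:n}]+\frac{\lambda\,\mathbb E[X_{1:n}^2]}{2\bigl(1-\lambda\,\mathbb E[X_{1:n}]\bigr)},$$ where both sides are $+\infty$ if $\mathbb E[X_{1:n}^2]=\infty$. Cost. For every job $k$, $\mathbb E[C_k]=n\,\mathbb E[X_{1:n}]$. This needs no stability assumption, and it holds for any other sequence of arrival times as well. -/

import Mathlib

open MeasureTheory ProbabilityTheory Filter Topology
open scoped ENNReal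

/-! ### Arrival and service processes -/

/-- Arrival time of job `k` (`k = 0, 1, 2, …`) for the interarrival times `τ`. -/
def arrivalTime (τ : ℕ → ℝ) (k : ℕ) : ℝ := ∑ j ∈ Finset.range (k + 1), τ j

/-- The stochastic input of an `n`-server replication system: jobs arrive according to a Poisson
process of rate `lam` (the interarrival times `τ k` are i.i.d. exponential), and the time `X k i`
that server `i` needs to serve its task of job `k` has law `ν`, independently over all jobs and
servers and independently of the arrivals. -/
structure IsForkJoinInput {Ω : Type*} [MeasurableSpace Ω] (n : ℕ) (lam : ℝ) (ν : Measure ℝ)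
    (P : Measure Ω) (τ : ℕ → Ω → ℝ) (X : ℕ → Fin n → Ω → ℝ) : Prop where
  arrival_law : ∀ k, HasLaw (τ k) (expMeasure lam) P
  service_law : ∀ k i, HasLaw (X k i) ν P
  indep : iIndepFun (fun c : ℕ ⊕ (ℕ × Fin n) => Sum.elim τ (fun p => X p.1 p.2) c) P

/-- The stochastic input of an M/G/1 queue: Poisson arrivals of rate `lam`, and i.i.d. service times
`S k` of law `G`, independent of the arrivals. -/
structure IsMG1Input {Ω : Type*} [MeasurableSpace Ω] (lam : ℝ) (G : Measure ℝ)
    (P : Measure Ω) (τ : ℕ → Ω → ℝ) (S : ℕ → Ω → ℝ) : Prop where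
  arrival_law : ∀ k, HasLaw (τ k) (expMeasure lam) P
  service_law : ∀ k, HasLaw (S k) G P
  indep : iIndepFun (fun c : ℕ ⊕ ℕ => Sum.elim τ S c) P

/-- The law of `X_{1:n} = min (X₁, …, Xₙ)` for `X₁, …, Xₙ` i.i.d. with law `ν` (for `n ≥ 1`). -/
noncomputable def minLaw (n : ℕ) (ν : Measure ℝ) : Measure ℝ :=
  (Measure.pi fun _ : Fin n => ν).map fun x => ⨅ i, x i

/-! ### The `(n,1)` fork-join system, pathwise

One job arrives at time `a`; `f i` is the time at which server `i` has been left by all tasks of the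
earlier jobs; `x i` is the service time of the new job's task at server `i`. -/

namespace ForkJoin

/-- The time at which the task at server `i` reaches the head of its first-come first-serve queue
and would start service, if it is not canceled before. -/
def taskStart {n : ℕ} (a : ℝ) (f : Fin n → ℝ) (i : Fin n) : ℝ := max a (f i)

/-- The time at which the job is complete: the first time at which one of its tasks is served. -/
noncomputable def completion {n : ℕ} (a : ℝ) (f x : Fin n → ℝ) : ℝ :=
  ⨅ i, (taskStart a f i + x i)

/-- The time at which the task at server `i` leaves: it is served, or it is canceled because the job
is complete (possibly while the task still waits in its queue). -/
noncomputable def taskExit {n : ℕ} (a : ℝ) (f x : Fin n → ℝ) (i : Fin n) : ℝ :=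
  min (taskStart a f i + x i) (completion a f x)

/-- The time that server `i` spends serving the job; it is zero if the task is canceled before it
reaches the head of its queue. -/
noncomputable def serverTime {n : ℕ} (a : ℝ) (f x : Fin n → ℝ) (i : Fin n) : ℝ :=
  max 0 (taskExit a f x i - taskStart a f i)

/-- `freeTime a x k i` is the time at which the tasks of all the jobs before job `k` have left
server `i`. The system is empty at time `0`. -/
noncomputable def freeTime {n : ℕ} (a : ℕ → ℝ) (x : ℕ → Fin n → ℝ) : ℕ → Fin n → ℝ
  | 0 => fun _ => 0
  | k + 1 => fun i => max (freeTime a x k i) (taskExit (a k) (freeTime a x k) (x k) i)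

/-- Latency of job `k`: the time from its arrival until one of its tasks is complete. -/
noncomputable def latency {n : ℕ} (a : ℕ → ℝ) (x : ℕ → Fin n → ℝ) (k : ℕ) : ℝ :=
  completion (a k) (freeTime a x k) (x k) - a k

/-- Computing cost of job `k`: the total time that the servers spend serving it. -/
noncomputable def cost {n : ℕ} (a : ℕ → ℝ) (x : ℕ → Fin n → ℝ) (k : ℕ) : ℝ :=
  ∑ i, serverTime (a k) (freeTime a x k) (x k) i

end ForkJoin

/-! ### The single-server first-come first-serve queue, pathwise -/

namespace SingleServer

/-- Departure time of job `k`, for arrival times `a` and service times `s`; the first job finds the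
server idle. -/
noncomputable def departure (a s : ℕ → ℝ) : ℕ → ℝ
  | 0 => a 0 + s 0
  | k + 1 => max (a (k + 1)) (departure a s k) + s (k + 1)

/-- Latency (waiting plus service time) of job `k`. -/
noncomputable def latency (a s : ℕ → ℝ) (k : ℕ) : ℝ := departure a s k - a k

end SingleServer

/-! ### Steady state and moments -/

/-- `π` is the steady-state law of the sequence `T 0, T 1, …`: the law of `T k` converges weakly to
`π` as `k → ∞`. -/
def IsSteadyStateLaw {Ω : Type*} [MeasurableSpace Ω] (P : Measure Ω) [IsProbabilityMeasure P]
    (T : ℕ → Ω → ℝ) (π : ProbabilityMeasure ℝ) : Prop :=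
  TendstoInDistribution T atTop (id : ℝ → ℝ) (fun _ => P) (π : Measure ℝ)

/-- Expectation in `[0, ∞]` of a nonnegative random variable. -/
noncomputable def expect {Ω : Type*} [MeasurableSpace Ω] (P : Measure Ω) (Y : Ω → ℝ) : ℝ≥0∞ :=
  ∫⁻ ω, ENNReal.ofReal (Y ω) ∂P

/-- The Pollaczek–Khinchine expression `m₁ + λ m₂ / (2 (1 - λ m₁))`, for `λ m₁ < 1`. -/
noncomputable def pollaczekKhinchine (lam : ℝ) (m₁ m₂ : ℝ≥0∞) : ℝ≥0∞ :=
  m₁ + ENNReal.ofReal lam * m₂ / (2 * (1 - ENNReal.ofReal lam * m₁))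

/-! ### The exponential law -/

/-! Pathwise reduction. If all servers become free of earlier jobs at the same instant, then all
tasks of the next job start together, the fastest one ends the job, and cancellation makes all of
them leave at that same instant (`ForkJoin.freeTime_const`). The fork-join system is therefore a
single first-come first-serve server with service times `⨅ i, X k i` (`ForkJoin.latency_eq`). Each
of the `n` servers works on a job for exactly that minimum, whatever the arrival times
(`ForkJoin.cost_eq`).

Steady state. Both systems are then M/G/1 queues governed by Lindley's recursion, and their
latencies have the common law `latencyLaw` (`hasLaw_latency`). Following Loynes, reading the inputs
in reverse order gives waits `backward k` of the same law that increase with `k`. By the strong law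
their limit `stationaryWait` is almost surely finite when the load is below one. Almost sure
convergence gives convergence in distribution, and monotone convergence gives convergence of the
means, finite or not.

Mean. The stationary wait W has the law of the positive part of W + S - τ. For exponential τ this is
an equation for the Laplace transform of W (`laplace_stationaryWait`). Its expansion at θ = 0 fixes
the unknown constant and then the mean (`expect_of_laplace_identity`). The limits are taken in
`ℝ≥0∞`, so an infinite second moment needs no separate argument. -/

theorem integral_expMeasure {r : ℝ} (f : ℝ → ℝ) (hr : 0 < r) :
    ∫ t, f t ∂(expMeasure r) = ∫ t in Set.Ioi 0, r * Real.exp (-(r * t)) * f t := by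
  have h : expMeasure r = volume.withDensity (exponentialPDF r) := rfl
  have hm : Measurable (exponentialPDF r) := (measurable_exponentialPDFReal r).ennreal_ofReal
  rw [h, integral_withDensity_eq_integral_toReal_smul hm
    (Eventually.of_forall fun x => ENNReal.ofReal_lt_top),
    ← integral_indicator measurableSet_Ioi]
  refine integral_congr_ae ?_
  have h0 : ∀ᵐ x : ℝ ∂volume, x ≠ 0 := by simp [ae_iff]
  filter_upwards [h0] with x hx
  rw [exponentialPDF_eq]
  rcases lt_or_gt_of_ne hx with h | h
  · simp [not_le.2 h, Set.indicator, h.le]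
  · simp only [h.le, if_true, smul_eq_mul, Set.indicator, Set.mem_Ioi, h]
    rw [ENNReal.toReal_ofReal (by positivity)]

theorem ae_pos_expMeasure (r : ℝ) : ∀ᵐ t ∂(expMeasure r), 0 < t := by
  have h : expMeasure r = volume.withDensity (exponentialPDF r) := rfl
  have hm : Measurable (exponentialPDF r) := (measurable_exponentialPDFReal r).ennreal_ofReal
  rw [h, ae_withDensity_iff hm]
  have h0 : ∀ᵐ x : ℝ ∂volume, x ≠ 0 := by simp [ae_iff]
  filter_upwards [h0] with x hx hx'
  by_contra! hlt
  exact hx' (exponentialPDF_of_neg (lt_of_le_of_ne hlt hx))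

theorem integral_id_expMeasure {r : ℝ} (hr : 0 < r) : ∫ t, t ∂(expMeasure r) = r⁻¹ := by
  rw [integral_expMeasure _ hr]
  have h := Real.integral_rpow_mul_exp_neg_mul_Ioi (a := 2) (r := r) (by norm_num) hr
  have h2 : ∫ t in Set.Ioi (0 : ℝ), r * Real.exp (-(r * t)) * t
      = r * ∫ t in Set.Ioi (0 : ℝ), t ^ ((2 : ℝ) - 1) * Real.exp (-(r * t)) := by
    rw [← integral_const_mul]
    refine setIntegral_congr_fun measurableSet_Ioi fun t _ => ?_
    norm_num
    ring
  rw [h2, h]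
  have : Real.Gamma 2 = 1 := by
    simp
  rw [this]
  norm_num
  field_simp

theorem integrable_id_expMeasure {r : ℝ} (hr : 0 < r) :
    Integrable (fun t : ℝ => t) (expMeasure r) := by
  by_contra h
  have := integral_id_expMeasure hr
  rw [integral_undef h] at this
  exact (inv_pos.2 hr).ne this

/-- The integral splits at `t = v`, beyond which the positive part vanishes. The factor `r - θ`
clears the denominator, so that `θ = r` is covered as well. -/
theorem integral_exp_residual_expMeasure {r θ v : ℝ} (hr : 0 < r) (hv : 0 ≤ v) :
    (r - θ) * ∫ t, Real.exp (-(θ * max 0 (v - t))) ∂(expMeasure r)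
      = r * Real.exp (-(θ * v)) - θ * Real.exp (-(r * v)) := by
  have hI : IntegrableOn (fun t => r * Real.exp (-(r * t))) (Set.Ioi v) := by
    simpa [IntegrableOn, neg_mul] using (exp_neg_integrableOn_Ioi v hr).const_mul r
  have hdom : Set.Ioi (0 : ℝ) = Set.Ioc 0 v ∪ Set.Ioi v := (Set.Ioc_union_Ioi_eq_Ioi hv).symm
  have e1 : Set.EqOn (fun t => r * Real.exp (-(r * t)) * Real.exp (-(θ * max 0 (v - t))))
      (fun t => r * Real.exp (-(r * t))) (Set.Ioi v) := by
    intro t ht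
    have : max 0 (v - t) = 0 := max_eq_left (by have : v < t := ht; linarith)
    simp [this]
  have e2 : Set.EqOn (fun t => r * Real.exp (-(r * t)) * Real.exp (-(θ * max 0 (v - t))))
      (fun t => r * Real.exp (-(θ * v)) * Real.exp (-((r - θ) * t))) (Set.Ioc 0 v) := by
    intro t ht
    have : max 0 (v - t) = v - t := max_eq_right (by linarith [ht.2])
    simp only [this]
    rw [mul_assoc, mul_assoc, ← Real.exp_add, ← Real.exp_add]
    ring_nf
  have hC : Continuous fun t : ℝ => r * Real.exp (-(θ * v)) * Real.exp (-((r - θ) * t)) := by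
    fun_prop
  rw [integral_expMeasure _ hr, hdom, setIntegral_union (Set.Ioc_disjoint_Ioi le_rfl)
    measurableSet_Ioi ((hC.integrableOn_Ioc).congr_fun e2.symm measurableSet_Ioc)
    (hI.congr_fun e1.symm measurableSet_Ioi),
    setIntegral_congr_fun measurableSet_Ioc e2, setIntegral_congr_fun measurableSet_Ioi e1,
    ← intervalIntegral.integral_of_le hv, mul_add, ← intervalIntegral.integral_const_mul]
  have h1 : ∫ t in (0 : ℝ)..v, (r - θ) * (r * Real.exp (-(θ * v)) * Real.exp (-((r - θ) * t)))
      = r * Real.exp (-(θ * v)) - r * Real.exp (-(r * v)) := by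
    have hd : ∀ t ∈ Set.uIcc (0 : ℝ) v, HasDerivAt
        (fun t => -(r * Real.exp (-(θ * v)) * Real.exp (-((r - θ) * t))))
        ((r - θ) * (r * Real.exp (-(θ * v)) * Real.exp (-((r - θ) * t)))) t := by
      intro t _
      have := ((((hasDerivAt_id t).const_mul (r - θ)).neg.exp).const_mul
        (r * Real.exp (-(θ * v)))).neg
      convert! this using 1
      simp
      ring
    rw [intervalIntegral.integral_eq_sub_of_hasDerivAt hd
      (Continuous.intervalIntegrable (by fun_prop) _ _)]
    simp only [mul_zero, neg_zero, Real.exp_zero, mul_assoc, ← Real.exp_add]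
    ring_nf
  have h2 : ∫ t in Set.Ioi v, r * Real.exp (-(r * t)) = Real.exp (-(r * v)) := by
    rw [integral_const_mul]
    have := integral_exp_mul_Ioi (a := -r) (by linarith) v
    simp only [neg_mul] at this
    rw [this]
    field_simp
  rw [h1, h2]
  ring

/-! ### Moments from the Laplace transform -/

/-- Fatou's lemma bounds the limit from below, and the bound by `F` bounds it from above. Neither
monotonicity in `n` nor a finite integral of `F` is needed. -/
theorem tendsto_lintegral_of_le {α : Type*} [MeasurableSpace α] {μ : Measure α}
    {f : ℕ → α → ℝ≥0∞} {F : α → ℝ≥0∞} (hf : ∀ n, Measurable (f n))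
    (hle : ∀ n, ∀ᵐ x ∂μ, f n x ≤ F x)
    (hlim : ∀ᵐ x ∂μ, Tendsto (fun n => f n x) atTop (𝓝 (F x))) :
    Tendsto (fun n => ∫⁻ x, f n x ∂μ) atTop (𝓝 (∫⁻ x, F x ∂μ)) := by
  refine tendsto_of_le_liminf_of_limsup_le ?_ ?_
  · calc ∫⁻ x, F x ∂μ = ∫⁻ x, liminf (fun n => f n x) atTop ∂μ :=
        lintegral_congr_ae (hlim.mono fun x hx => hx.liminf_eq.symm)
      _ ≤ _ := lintegral_liminf_le hf
  · exact limsup_le_of_le (by isBoundedDefault)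
      (Eventually.of_forall fun n => lintegral_mono_ae (hle n))

theorem exp_neg_le_quadratic {y : ℝ} (hy : 0 ≤ y) : Real.exp (-y) ≤ 1 - y + y ^ 2 / 2 := by
  have h1 := Real.quadratic_le_exp_of_nonneg hy
  have h2 : Real.exp y * Real.exp (-y) = 1 := by rw [← Real.exp_add]; simp
  have h3 := Real.exp_pos (-y)
  have h4 : 0 ≤ 1 - y + y ^ 2 / 2 := by nlinarith [sq_nonneg (y - 1)]
  -- The product (1 + y + y²/2)(1 - y + y²/2) equals 1 + y⁴/4.
  have h5 : 1 ≤ Real.exp y * (1 - y + y ^ 2 / 2) := by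
    nlinarith [mul_le_mul_of_nonneg_right h1 h4, sq_nonneg (y ^ 2)]
  have h6 := Real.exp_pos y
  nlinarith

theorem tendsto_first_order_laplace {θ : ℕ → ℝ} (hθ : ∀ n, 0 < θ n)
    (hθ0 : Tendsto θ atTop (𝓝 0)) {x : ℝ} (hx : 0 ≤ x) :
    Tendsto (fun n => (1 - Real.exp (-(θ n * x))) / θ n) atTop (𝓝 x) := by
  refine tendsto_of_tendsto_of_tendsto_of_le_of_le (g := fun n => x - θ n * (x ^ 2 / 2))
    (h := fun _ => x) ?_ tendsto_const_nhds ?_ ?_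
  · simpa using (hθ0.mul_const (x ^ 2 / 2)).const_sub x
  · intro n
    have := exp_neg_le_quadratic (mul_nonneg (hθ n).le hx)
    simp only
    rw [le_div_iff₀ (hθ n)]
    nlinarith
  · intro n
    have := Real.one_sub_le_exp_neg (θ n * x)
    simp only
    rw [div_le_iff₀ (hθ n)]
    nlinarith

theorem tendsto_second_order_laplace {θ : ℕ → ℝ} (hθ : ∀ n, 0 < θ n)
    (hθ0 : Tendsto θ atTop (𝓝 0)) {x : ℝ} (hx : 0 ≤ x) :
    Tendsto (fun n => (x - (1 - Real.exp (-(θ n * x))) / θ n) / θ n) atTop (𝓝 (x ^ 2 / 2)) := by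
  have hsmall : ∀ᶠ n in atTop, θ n * x < 1 := by
    have : Tendsto (fun n => θ n * x) atTop (𝓝 0) := by simpa using hθ0.mul_const x
    exact this.eventually_lt_const one_pos
  -- The constant 2/9 = 4 / (3! · 3) is the third-order remainder constant of `Real.exp_bound`,
  -- which requires an argument of absolute value at most 1.
  refine tendsto_of_tendsto_of_tendsto_of_le_of_le'
    (g := fun n => x ^ 2 / 2 - θ n * (x ^ 3 * (2 / 9))) (h := fun _ => x ^ 2 / 2) ?_
    tendsto_const_nhds ?_ ?_
  · simpa using (hθ0.mul_const (x ^ 3 * (2 / 9))).const_sub (x ^ 2 / 2)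
  · filter_upwards [hsmall] with n hn
    have hp := hθ n
    have hy : 0 ≤ θ n * x := mul_nonneg hp.le hx
    have h := Real.exp_bound (x := -(θ n * x)) (by rw [abs_neg, abs_of_nonneg hy]; exact hn.le)
      (n := 3) (by norm_num)
    rw [abs_neg, abs_of_nonneg hy] at h
    have h' := (abs_le.1 h).1
    norm_num [Finset.sum_range_succ, Nat.factorial] at h'
    rw [le_div_iff₀ hp, le_sub_iff_add_le, ← le_sub_iff_add_le', div_le_iff₀ hp]
    nlinarith
  · refine Eventually.of_forall fun n => ?_
    have hp := hθ n
    have := exp_neg_le_quadratic (mul_nonneg hp.le hx)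
    rw [div_le_iff₀ hp, sub_le_iff_le_add, ← sub_le_iff_le_add', le_div_iff₀ hp]
    nlinarith

theorem first_order_laplace_nonneg {θ x : ℝ} (hθ : 0 < θ) (hx : 0 ≤ x) :
    0 ≤ (1 - Real.exp (-(θ * x))) / θ := by
  refine div_nonneg (sub_nonneg.2 (Real.exp_le_one_iff.2 ?_)) hθ.le
  nlinarith

theorem first_order_laplace_le {θ x : ℝ} (hθ : 0 < θ) :
    (1 - Real.exp (-(θ * x))) / θ ≤ x := by
  have := Real.one_sub_le_exp_neg (θ * x)
  rw [div_le_iff₀ hθ]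
  nlinarith

theorem second_order_laplace_le {θ x : ℝ} (hθ : 0 < θ) (hx : 0 ≤ x) :
    (x - (1 - Real.exp (-(θ * x))) / θ) / θ ≤ x ^ 2 / 2 := by
  have := exp_neg_le_quadratic (mul_nonneg hθ.le hx)
  rw [div_le_iff₀ hθ, sub_le_iff_le_add, ← sub_le_iff_le_add', le_div_iff₀ hθ]
  nlinarith

theorem integrable_exp_neg_mul {μ : Measure ℝ} [IsFiniteMeasure μ] (hμ : ∀ᵐ x ∂μ, 0 ≤ x)
    {θ : ℝ} (hθ : 0 ≤ θ) : Integrable (fun x => Real.exp (-(θ * x))) μ := by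
  refine Integrable.of_bound (by fun_prop) 1 (hμ.mono fun x hx => ?_)
  rw [Real.norm_eq_abs, abs_of_pos (Real.exp_pos _), Real.exp_le_one_iff]
  nlinarith

/-- The Laplace transform of a law on `[0, ∞)` determines its first moment. -/
theorem tendsto_laplace_expect {μ : Measure ℝ} [IsProbabilityMeasure μ] (hμ : ∀ᵐ x ∂μ, 0 ≤ x)
    {θ : ℕ → ℝ} (hθ : ∀ n, 0 < θ n) (hθ0 : Tendsto θ atTop (𝓝 0)) :
    Tendsto (fun n => ENNReal.ofReal ((1 - ∫ x, Real.exp (-(θ n * x)) ∂μ) / θ n)) atTop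
      (𝓝 (expect μ fun x => x)) := by
  have h (n : ℕ) : ENNReal.ofReal ((1 - ∫ x, Real.exp (-(θ n * x)) ∂μ) / θ n)
      = ∫⁻ x, ENNReal.ofReal ((1 - Real.exp (-(θ n * x))) / θ n) ∂μ := by
    have hi := integrable_exp_neg_mul hμ (hθ n).le
    have hj : Integrable (fun x => (1 - Real.exp (-(θ n * x))) / θ n) μ :=
      ((integrable_const 1).sub hi).div_const _
    rw [← ofReal_integral_eq_lintegral_ofReal hj
      (hμ.mono fun x hx => first_order_laplace_nonneg (hθ n) hx), integral_div,
      integral_sub (integrable_const 1) hi]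
    simp
  simp_rw [h]
  refine tendsto_lintegral_of_le (fun n => by fun_prop) (fun n => ?_) ?_
  · exact Eventually.of_forall fun x => ENNReal.ofReal_le_ofReal (first_order_laplace_le (hθ n))
  · exact hμ.mono fun x hx => (ENNReal.continuous_ofReal.tendsto _).comp
      (tendsto_first_order_laplace hθ hθ0 hx)

theorem integrable_id_of_expect_ne_top {μ : Measure ℝ} (hμ : ∀ᵐ x ∂μ, 0 ≤ x)
    (h : expect μ (fun x => x) ≠ ∞) : Integrable (fun x : ℝ => x) μ :=
  (lintegral_ofReal_ne_top_iff_integrable measurable_id.aestronglyMeasurable hμ).1 h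

/-- The Laplace transform of a law on `[0, ∞)` of finite mean determines its second moment. -/
theorem tendsto_laplace_expect_sq {μ : Measure ℝ} [IsProbabilityMeasure μ]
    (hμ : ∀ᵐ x ∂μ, 0 ≤ x) (hint : Integrable (fun x : ℝ => x) μ)
    {θ : ℕ → ℝ} (hθ : ∀ n, 0 < θ n) (hθ0 : Tendsto θ atTop (𝓝 0)) :
    Tendsto (fun n => ENNReal.ofReal
      ((∫ x, x ∂μ - (1 - ∫ x, Real.exp (-(θ n * x)) ∂μ) / θ n) / θ n)) atTop
      (𝓝 (expect μ (fun x => x ^ 2) / 2)) := by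
  have h (n : ℕ) : ENNReal.ofReal ((∫ x, x ∂μ - (1 - ∫ x, Real.exp (-(θ n * x)) ∂μ) / θ n) / θ n)
      = ∫⁻ x, ENNReal.ofReal ((x - (1 - Real.exp (-(θ n * x))) / θ n) / θ n) ∂μ := by
    have hi := integrable_exp_neg_mul hμ (hθ n).le
    have hj : Integrable (fun x => (1 - Real.exp (-(θ n * x))) / θ n) μ :=
      ((integrable_const 1).sub hi).div_const _
    have hk : Integrable (fun x => (x - (1 - Real.exp (-(θ n * x))) / θ n) / θ n) μ :=
      (hint.sub hj).div_const _
    rw [← ofReal_integral_eq_lintegral_ofReal hk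
      (hμ.mono fun x hx => div_nonneg (sub_nonneg.2 (first_order_laplace_le (hθ n))) (hθ n).le),
      integral_div, integral_sub hint hj, integral_div, integral_sub (integrable_const 1) hi]
    simp
  have h2 : expect μ (fun x => x ^ 2) / 2 = ∫⁻ x, ENNReal.ofReal (x ^ 2 / 2) ∂μ := by
    rw [expect, div_eq_mul_inv, ← lintegral_mul_const _ (by fun_prop)]
    refine lintegral_congr fun x => ?_
    rw [← div_eq_mul_inv, ENNReal.ofReal_div_of_pos two_pos]
    simp
  simp_rw [h, h2]
  refine tendsto_lintegral_of_le (fun n => by fun_prop) (fun n => ?_) ?_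
  · exact hμ.mono fun x hx => ENNReal.ofReal_le_ofReal (second_order_laplace_le (hθ n) hx)
  · exact hμ.mono fun x hx => (ENNReal.continuous_ofReal.tendsto _).comp
      (tendsto_second_order_laplace hθ hθ0 hx)

/-- The mean stationary wait, from the Laplace transform equation of the M/G/1 queue. -/
theorem expect_of_laplace_identity {lam c : ℝ} (hlam : 0 < lam) {μ G : Measure ℝ}
    [IsProbabilityMeasure μ] [IsProbabilityMeasure G] (hμ : ∀ᵐ x ∂μ, 0 ≤ x) (hG : ∀ᵐ x ∂G, 0 ≤ x)
    (hload : ENNReal.ofReal lam * expect G (fun x => x) < 1)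
    (hid : ∀ θ, 0 < θ → (lam - θ) * ∫ x, Real.exp (-(θ * x)) ∂μ
      = lam * ((∫ x, Real.exp (-(θ * x)) ∂μ) * ∫ x, Real.exp (-(θ * x)) ∂G) - θ * c) :
    expect μ (fun x => x) = ENNReal.ofReal lam * expect G (fun x => x ^ 2)
      / (2 * (1 - ENNReal.ofReal lam * expect G (fun x => x))) := by
  have hfin : expect G (fun x => x) ≠ ∞ := by
    intro h
    rw [h, ENNReal.mul_top (by simpa using hlam)] at hload
    exact absurd hload (by simp)
  have hint := integrable_id_of_expect_ne_top hG hfin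
  set m : ℝ := ∫ x, x ∂G with hm
  have hm1 : expect G (fun x => x) = ENNReal.ofReal m :=
    (ofReal_integral_eq_lintegral_ofReal hint hG).symm
  have hm0 : 0 ≤ m := integral_nonneg_of_ae hG
  have hρ : lam * m < 1 := by
    rw [hm1, ← ENNReal.ofReal_mul hlam.le, ENNReal.ofReal_lt_one] at hload
    exact hload
  let θ : ℕ → ℝ := fun n => 1 / ((n : ℝ) + 1)
  have hθ : ∀ n, 0 < θ n := fun n => Nat.one_div_pos_of_nat
  have hθ0 : Tendsto θ atTop (𝓝 0) := tendsto_one_div_add_atTop_nhds_zero_nat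
  set φ : ℕ → ℝ := fun n => ∫ x, Real.exp (-(θ n * x)) ∂μ with hφ
  set g : ℕ → ℝ := fun n => (1 - ∫ x, Real.exp (-(θ n * x)) ∂G) / θ n with hg
  have hgm : Tendsto g atTop (𝓝 m) := by
    have h := tendsto_laplace_expect hG hθ hθ0
    have h' := (ENNReal.tendsto_toReal hfin).comp h
    rw [hm1, ENNReal.toReal_ofReal hm0] at h'
    refine h'.congr fun n => ?_
    refine ENNReal.toReal_ofReal (div_nonneg (sub_nonneg.2 ?_) (hθ n).le)
    calc ∫ x, Real.exp (-(θ n * x)) ∂G ≤ ∫ _, (1 : ℝ) ∂G := by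
          refine integral_mono_ae (integrable_exp_neg_mul hG (hθ n).le) (integrable_const _) ?_
          filter_upwards [hG] with x hx
          exact Real.exp_le_one_iff.2 (by nlinarith [hθ n])
      _ = 1 := by simp
  have hφ1 : Tendsto φ atTop (𝓝 1) := by
    have : Tendsto φ atTop (𝓝 (∫ _, (1 : ℝ) ∂μ)) := by
      refine tendsto_integral_of_dominated_convergence (fun _ => 1)
        (fun n => by fun_prop) (integrable_const _) (fun n => ?_) (Eventually.of_forall fun x => ?_)
      · filter_upwards [hμ] with x hx
        rw [Real.norm_eq_abs, abs_of_pos (Real.exp_pos _), Real.exp_le_one_iff]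
        nlinarith [hθ n]
      · have : Tendsto (fun n => -(θ n * x)) atTop (𝓝 0) := by
          simpa using (hθ0.mul_const x).neg
        simpa [Function.comp_def] using (Real.continuous_exp.tendsto 0).comp this
    simpa using this
  -- The hypothesis divided by θ. Letting θ → 0 yields `c = 1 - lam * m`; subtracting this limit and
  -- dividing by θ once more isolates the mean.
  have hc (n : ℕ) : φ n * (1 - lam * g n) = c := by
    have h := hid (θ n) (hθ n)
    have hp := (hθ n).ne'
    simp only [hφ, hg]
    field_simp
    linarith
  have hc1 : c = 1 - lam * m := by
    have h1 : Tendsto (fun n => φ n * (1 - lam * g n)) atTop (𝓝 (1 * (1 - lam * m))) :=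
      hφ1.mul ((hgm.const_mul lam).const_sub 1)
    simp_rw [hc, one_mul] at h1
    exact tendsto_nhds_unique tendsto_const_nhds h1
  have hkey (n : ℕ) : (1 - φ n) / θ n * (1 - lam * g n) = lam * ((m - g n) / θ n) := by
    have h : (1 - φ n) * (1 - lam * g n) = lam * (m - g n) := by linarith [hc n]
    rw [div_mul_eq_mul_div, h, mul_div_assoc]
  have hgle : ∀ᶠ n in atTop, 0 < 1 - lam * g n :=
    ((hgm.const_mul lam).const_sub 1).eventually_const_lt (by linarith)
  -- The first factor may tend to `∞`; the product still converges because the second has a nonzero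
  -- limit.
  have hlim1 : Tendsto (fun n => ENNReal.ofReal ((1 - φ n) / θ n) *
      ENNReal.ofReal (1 - lam * g n)) atTop
      (𝓝 (expect μ (fun x => x) * ENNReal.ofReal (1 - lam * m))) := by
    refine ENNReal.Tendsto.mul (tendsto_laplace_expect hμ hθ hθ0) (Or.inr ENNReal.ofReal_ne_top)
      ((ENNReal.continuous_ofReal.tendsto _).comp ((hgm.const_mul lam).const_sub 1))
      (Or.inl ?_)
    simpa using hρ
  have hlim2 : Tendsto (fun n => ENNReal.ofReal lam * ENNReal.ofReal ((m - g n) / θ n)) atTop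
      (𝓝 (ENNReal.ofReal lam * (expect G (fun x => x ^ 2) / 2))) :=
    ENNReal.Tendsto.const_mul (tendsto_laplace_expect_sq hG hint hθ hθ0)
      (Or.inr ENNReal.ofReal_ne_top)
  have heq : expect μ (fun x => x) * ENNReal.ofReal (1 - lam * m)
      = ENNReal.ofReal lam * (expect G (fun x => x ^ 2) / 2) := by
    refine tendsto_nhds_unique (hlim1.congr' ?_) hlim2
    filter_upwards [hgle] with n hn
    rw [← ENNReal.ofReal_mul' hn.le, hkey, ENNReal.ofReal_mul hlam.le]
  have h1m : ENNReal.ofReal (1 - lam * m) = 1 - ENNReal.ofReal lam * expect G (fun x => x) := by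
    rw [hm1, ← ENNReal.ofReal_mul hlam.le, ENNReal.ofReal_sub _ (by positivity), ENNReal.ofReal_one]
  have hne : ENNReal.ofReal (1 - lam * m) ≠ 0 := by simpa using hρ
  rw [← h1m, ENNReal.eq_div_iff (by simpa using hρ) (ENNReal.mul_ne_top (by simp) (by simp)),
    mul_assoc, mul_comm (ENNReal.ofReal (1 - lam * m)), heq, ← mul_assoc, mul_comm 2, mul_assoc,
    ENNReal.mul_div_cancel (by simp) (by simp)]

/-! ### The backward recursion on the canonical space -/

/-- The sequence `p.1, p.2 0, p.2 1, …`. -/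
def seqCons {α : Type*} (p : α × (ℕ → α)) : ℕ → α
  | 0 => p.1
  | n + 1 => p.2 n

theorem measurable_seqCons {α : Type*} [MeasurableSpace α] :
    Measurable (seqCons : α × (ℕ → α) → ℕ → α) := by
  refine measurable_pi_iff.2 fun n => ?_
  cases n with
  | zero => exact measurable_fst
  | succ n => exact (measurable_pi_apply n).comp measurable_snd

/-- Prepending an independent copy preserves the law of an i.i.d. sequence. Finite boxes determine
the infinite product, and on a box the factor at index 0 splits off. Through this, one step of the
backward recursion becomes a change of variables. -/
theorem map_seqCons_infinitePi {α : Type*} [MeasurableSpace α] (κ : Measure α)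
    [IsProbabilityMeasure κ] :
    (κ.prod (Measure.infinitePi fun _ : ℕ => κ)).map seqCons
      = Measure.infinitePi fun _ : ℕ => κ := by
  classical
  refine Measure.eq_infinitePi _ fun s t ht => ?_
  have hpre : seqCons ⁻¹' (Set.pi s t)
      = (if 0 ∈ s then t 0 else Set.univ) ×ˢ
        Set.pi (s.preimage Nat.succ Nat.succ_injective.injOn) (fun n => t (n + 1)) := by
    ext p
    simp only [Set.mem_preimage, Set.mem_pi, Set.mem_prod, Finset.coe_preimage, Finset.mem_coe]
    constructor
    · intro h
      refine ⟨?_, fun n hn => h (n + 1) hn⟩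
      split_ifs with h0
      · exact h 0 h0
      · trivial
    · rintro ⟨h0, h1⟩ n hn
      cases n with
      | zero => rwa [if_pos hn] at h0
      | succ n => exact h1 n hn
  rw [Measure.map_apply measurable_seqCons
      (MeasurableSet.pi s.countable_toSet fun i _ => ht i), hpre, Measure.prod_prod,
    Measure.infinitePi_pi _ fun i _ => ht (i + 1),
    Finset.prod_preimage' Nat.succ s Nat.succ_injective.injOn (fun i => κ (t i))]
  have hr : s.filter (fun x => x ∈ Set.range Nat.succ) = s.erase 0 := by
    ext x
    cases x <;> simp
  rw [hr]
  split_ifs with h0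
  · exact Finset.mul_prod_erase s (fun i => κ (t i)) h0
  · rw [Finset.erase_eq_of_notMem h0, measure_univ, one_mul]

/-- The waiting time of the last of `k + 1` jobs, where `u 0`, `u 1`, … are the service times and
interarrival times in reverse order. -/
noncomputable def backward : ℕ → (ℕ → ℝ × ℝ) → ℝ
  | 0, _ => 0
  | k + 1, u => max 0 (backward k (fun i => u (i + 1)) + (u 0).1 - (u 0).2)

@[fun_prop]
theorem measurable_backward (k : ℕ) : Measurable (backward k) := by
  induction k with
  | zero => exact measurable_const
  | succ k ih =>
    have : Measurable fun u : ℕ → ℝ × ℝ => backward k (fun i => u (i + 1)) :=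
      ih.comp (by fun_prop)
    change Measurable fun u : ℕ → ℝ × ℝ =>
      max 0 (backward k (fun i => u (i + 1)) + (u 0).1 - (u 0).2)
    fun_prop

theorem backward_nonneg (k : ℕ) (u : ℕ → ℝ × ℝ) : 0 ≤ backward k u := by
  cases k with
  | zero => exact le_rfl
  | succ k => exact le_max_left _ _

/-- Lengthening the history replaces an initial wait of 0 by one that is at least 0, and the
recursion is monotone in the initial wait. -/
theorem monotone_backward (u : ℕ → ℝ × ℝ) : Monotone fun k => backward k u := by
  refine monotone_nat_of_le_succ fun k => ?_
  induction k generalizing u with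
  | zero => exact backward_nonneg 1 u
  | succ k ih =>
    have := ih fun i => u (i + 1)
    exact max_le_max le_rfl (by linarith)

/-- Unrolled, `backward k` is the maximum of the first partial sums of the increments, including the
empty sum. In the induction the bound for the shifted sequence is `C` minus the first increment. -/
theorem backward_le {u : ℕ → ℝ × ℝ} {C : ℝ} (hC0 : 0 ≤ C)
    (hC : ∀ n, ∑ i ∈ Finset.range n, ((u i).1 - (u i).2) ≤ C) (k : ℕ) : backward k u ≤ C := by
  induction k generalizing u C with
  | zero => exact hC0
  | succ k ih =>
    have h1 := hC 1
    rw [Finset.sum_range_one] at h1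
    refine max_le hC0 ?_
    have := ih (u := fun i => u (i + 1)) (C := C - ((u 0).1 - (u 0).2)) (by linarith) fun n => by
      have := hC (n + 1)
      rw [Finset.sum_range_succ'] at this
      linarith
    linarith

/-- The limit of the backward recursion: the stationary waiting time. -/
noncomputable def stationaryWait (u : ℕ → ℝ × ℝ) : ℝ := ⨆ k, backward k u

@[fun_prop]
theorem measurable_stationaryWait : Measurable stationaryWait :=
  Measurable.iSup measurable_backward

/-- This holds for every `u`, since a real supremum of an unbounded family is 0 by convention. -/
theorem stationaryWait_nonneg (u : ℕ → ℝ × ℝ) : 0 ≤ stationaryWait u :=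
  Real.iSup_nonneg fun k => backward_nonneg k u

theorem tendsto_backward {u : ℕ → ℝ × ℝ} (h : BddAbove (Set.range fun k => backward k u)) :
    Tendsto (fun k => backward k u) atTop (𝓝 (stationaryWait u)) :=
  tendsto_atTop_ciSup (monotone_backward u) h

/-- The law of i.i.d. pairs of a service time of law `G` and an interarrival time. -/
noncomputable def inputLaw (lam : ℝ) (G : Measure ℝ) : Measure (ℕ → ℝ × ℝ) :=
  Measure.infinitePi fun _ => G.prod (expMeasure lam)

section Canonical

variable {lam : ℝ} {G : Measure ℝ}

theorem isProbabilityMeasure_inputLaw (hlam : 0 < lam) [IsProbabilityMeasure G] :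
    IsProbabilityMeasure (inputLaw lam G) := by
  have := isProbabilityMeasure_expMeasure hlam
  unfold inputLaw
  infer_instance

/-- The increments have mean E[S] - 1/λ < 0, so by the strong law their partial sums are eventually
nonpositive, hence bounded above. -/
theorem ae_bddAbove_backward (hlam : 0 < lam) [IsProbabilityMeasure G]
    (hint : Integrable (fun x : ℝ => x) G) (hload : lam * ∫ x, x ∂G < 1) :
    ∀ᵐ u ∂(inputLaw lam G), BddAbove (Set.range fun k => backward k u) := by
  have := isProbabilityMeasure_expMeasure hlam
  have := isProbabilityMeasure_inputLaw (G := G) hlam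
  let Y : ℕ → (ℕ → ℝ × ℝ) → ℝ := fun i u => (u i).1 - (u i).2
  have hsub : Measurable fun z : ℝ × ℝ => z.1 - z.2 := by fun_prop
  have heval (i : ℕ) : MeasurePreserving (fun u : ℕ → ℝ × ℝ => u i) (inputLaw lam G)
      (G.prod (expMeasure lam)) :=
    measurePreserving_eval_infinitePi (fun _ : ℕ => G.prod (expMeasure lam)) i
  have i1 : Integrable (fun z : ℝ × ℝ => z.1) (G.prod (expMeasure lam)) := hint.comp_fst _
  have i2 : Integrable (fun z : ℝ × ℝ => z.2) (G.prod (expMeasure lam)) :=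
    (integrable_id_expMeasure hlam).comp_snd _
  have hZ : Integrable (fun z : ℝ × ℝ => z.1 - z.2) (G.prod (expMeasure lam)) := i1.sub i2
  have hmean : ∫ u, Y 0 u ∂(inputLaw lam G) < 0 := by
    have e : ∫ u, Y 0 u ∂(inputLaw lam G)
        = ∫ z, (z.1 - z.2) ∂(G.prod (expMeasure lam)) := by
      rw [← (heval 0).map_eq, integral_map (heval 0).measurable.aemeasurable
        hsub.aestronglyMeasurable]
    rw [e, integral_sub i1 i2, integral_fun_fst (fun x : ℝ => x), integral_fun_snd (fun x : ℝ => x),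
      integral_id_expMeasure hlam]
    simp only [probReal_univ, one_smul]
    rw [sub_neg, inv_eq_one_div, lt_div_iff₀ hlam]
    linarith
  have hind : iIndepFun Y (inputLaw lam G) :=
    iIndepFun_infinitePi (P := fun _ : ℕ => G.prod (expMeasure lam))
      (X := fun _ z => z.1 - z.2) fun _ => hsub
  have hident (i : ℕ) : IdentDistrib (Y i) (Y 0) (inputLaw lam G) (inputLaw lam G) := by
    have : IdentDistrib (fun u : ℕ → ℝ × ℝ => u i) (fun u => u 0) (inputLaw lam G)
        (inputLaw lam G) :=
      ⟨(heval i).measurable.aemeasurable, (heval 0).measurable.aemeasurable, by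
        rw [(heval i).map_eq, (heval 0).map_eq]⟩
    exact this.comp hsub
  have hint0 : Integrable (Y 0) (inputLaw lam G) := (heval 0).integrable_comp_of_integrable hZ
  filter_upwards [strong_law_ae_real Y hint0 (fun i j hij => hind.indepFun hij) hident] with u hu
  have hev : ∀ᶠ n in atTop, ∑ i ∈ Finset.range n, ((u i).1 - (u i).2) ≤ 0 := by
    filter_upwards [hu.eventually_lt_const hmean, eventually_gt_atTop 0] with n hn hn0
    rw [div_lt_iff₀ (by exact_mod_cast hn0), zero_mul] at hn
    exact hn.le
  obtain ⟨C, hC⟩ := (isBoundedUnder_of_eventually_le hev).bddAbove_range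
  refine ⟨max 0 C, ?_⟩
  rintro _ ⟨k, rfl⟩
  exact backward_le (le_max_left _ _)
    (fun n => (hC ⟨n, rfl⟩).trans (le_max_right _ _)) k

/-- Letting k → ∞ in the recursion for `backward (k + 1)` gives a fixed-point equation. Boundedness
is needed on both sides, and shift invariance supplies it for `seqCons p`. -/
theorem ae_stationaryWait_seqCons (hlam : 0 < lam) [IsProbabilityMeasure G]
    (hbdd : ∀ᵐ u ∂(inputLaw lam G), BddAbove (Set.range fun k => backward k u)) :
    ∀ᵐ p ∂((G.prod (expMeasure lam)).prod (inputLaw lam G)),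
      stationaryWait (seqCons p) = max 0 (stationaryWait p.2 + p.1.1 - p.1.2) := by
  have := isProbabilityMeasure_expMeasure hlam
  have := isProbabilityMeasure_inputLaw (G := G) hlam
  have h1 : ∀ᵐ p ∂((G.prod (expMeasure lam)).prod (inputLaw lam G)),
      BddAbove (Set.range fun k => backward k (seqCons p)) := by
    refine ae_of_ae_map measurable_seqCons.aemeasurable
      (p := fun u => BddAbove (Set.range fun k => backward k u)) ?_
    rw [inputLaw, map_seqCons_infinitePi]
    exact hbdd
  have h2 : ∀ᵐ p ∂((G.prod (expMeasure lam)).prod (inputLaw lam G)),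
      BddAbove (Set.range fun k => backward k p.2) :=
    Measure.quasiMeasurePreserving_snd.ae hbdd
  filter_upwards [h1, h2] with p hp1 hp2
  have t1 := (tendsto_add_atTop_iff_nat 1).2 (tendsto_backward hp1)
  have t2 : Tendsto (fun k => max 0 (backward k p.2 + p.1.1 - p.1.2)) atTop
      (𝓝 (max 0 (stationaryWait p.2 + p.1.1 - p.1.2))) :=
    tendsto_const_nhds.max (((tendsto_backward hp2).add_const _).sub_const _)
  exact tendsto_nhds_unique t1 t2

/-- Given a service time `x`, this is the exponential integral with `v = w + x`. -/
theorem integral_exp_max_sub (hlam : 0 < lam) [IsProbabilityMeasure G] (hG : ∀ᵐ x ∂G, 0 ≤ x)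
    {θ w : ℝ} (hθ : 0 < θ) (hw : 0 ≤ w) :
    (lam - θ) * ∫ z, Real.exp (-(θ * max 0 (w + z.1 - z.2))) ∂(G.prod (expMeasure lam))
      = lam * (Real.exp (-(θ * w)) * ∫ x, Real.exp (-(θ * x)) ∂G)
        - θ * (Real.exp (-(lam * w)) * ∫ x, Real.exp (-(lam * x)) ∂G) := by
  have := isProbabilityMeasure_expMeasure hlam
  have hi : Integrable (fun z : ℝ × ℝ => Real.exp (-(θ * max 0 (w + z.1 - z.2))))
      (G.prod (expMeasure lam)) := by
    refine Integrable.of_bound (by fun_prop) 1 (Eventually.of_forall fun z => ?_)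
    rw [Real.norm_eq_abs, abs_of_pos (Real.exp_pos _), Real.exp_le_one_iff]
    have := mul_nonneg hθ.le (le_max_left 0 (w + z.1 - z.2))
    linarith
  rw [integral_prod _ hi, ← integral_const_mul]
  have e : ∀ᵐ x ∂G, (lam - θ) * ∫ t, Real.exp (-(θ * max 0 (w + x - t))) ∂(expMeasure lam)
      = lam * Real.exp (-(θ * w)) * Real.exp (-(θ * x))
        - θ * Real.exp (-(lam * w)) * Real.exp (-(lam * x)) := by
    filter_upwards [hG] with x hx
    rw [integral_exp_residual_expMeasure hlam (by linarith), mul_assoc, mul_assoc, ← Real.exp_add,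
      ← Real.exp_add]
    ring_nf
  rw [integral_congr_ae e, integral_sub ((integrable_exp_neg_mul hG hθ.le).const_mul _)
    ((integrable_exp_neg_mul hG hlam.le).const_mul _), integral_const_mul, integral_const_mul,
    mul_assoc, mul_assoc]

/-- The fixed-point equation turns one transform of the wait into an average over an independent
wait, service time and interarrival time. The product in the last term is E[exp(-λ(W + S))], the
probability that τ exceeds W + S. -/
theorem laplace_stationaryWait (hlam : 0 < lam) [IsProbabilityMeasure G] (hG : ∀ᵐ x ∂G, 0 ≤ x)
    (hbdd : ∀ᵐ u ∂(inputLaw lam G), BddAbove (Set.range fun k => backward k u))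
    {θ : ℝ} (hθ : 0 < θ) :
    (lam - θ) * ∫ u, Real.exp (-(θ * stationaryWait u)) ∂(inputLaw lam G)
      = lam * ((∫ u, Real.exp (-(θ * stationaryWait u)) ∂(inputLaw lam G))
          * ∫ x, Real.exp (-(θ * x)) ∂G)
        - θ * ((∫ u, Real.exp (-(lam * stationaryWait u)) ∂(inputLaw lam G))
          * ∫ x, Real.exp (-(lam * x)) ∂G) := by
  have := isProbabilityMeasure_expMeasure hlam
  have := isProbabilityMeasure_inputLaw (G := G) hlam
  have hexp {r : ℝ} (hr : 0 < r) :
      Integrable (fun u => Real.exp (-(r * stationaryWait u))) (inputLaw lam G) := by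
    refine Integrable.of_bound (by fun_prop) 1 (Eventually.of_forall fun u => ?_)
    rw [Real.norm_eq_abs, abs_of_pos (Real.exp_pos _), Real.exp_le_one_iff]
    have := mul_nonneg hr.le (stationaryWait_nonneg u)
    linarith
  have hi : Integrable (fun p : (ℝ × ℝ) × (ℕ → ℝ × ℝ) =>
      Real.exp (-(θ * max 0 (stationaryWait p.2 + p.1.1 - p.1.2))))
      ((G.prod (expMeasure lam)).prod (inputLaw lam G)) := by
    refine Integrable.of_bound (by fun_prop) 1 (Eventually.of_forall fun p => ?_)
    rw [Real.norm_eq_abs, abs_of_pos (Real.exp_pos _), Real.exp_le_one_iff]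
    have := mul_nonneg hθ.le (le_max_left 0 (stationaryWait p.2 + p.1.1 - p.1.2))
    linarith
  have e1 : ∫ u, Real.exp (-(θ * stationaryWait u)) ∂(inputLaw lam G)
      = ∫ u, ∫ z, Real.exp (-(θ * max 0 (stationaryWait u + z.1 - z.2)))
        ∂(G.prod (expMeasure lam)) ∂(inputLaw lam G) := by
    rw [← integral_prod_symm _ hi]
    have hm : Measurable fun u => Real.exp (-(θ * stationaryWait u)) := by fun_prop
    conv_lhs => rw [inputLaw, ← map_seqCons_infinitePi]
    rw [integral_map measurable_seqCons.aemeasurable hm.aestronglyMeasurable]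
    refine integral_congr_ae ?_
    filter_upwards [ae_stationaryWait_seqCons hlam hbdd] with p hp
    rw [hp]
  conv_lhs => rw [e1]
  rw [← integral_const_mul]
  simp_rw [integral_exp_max_sub hlam hG hθ (stationaryWait_nonneg _)]
  rw [integral_sub (((hexp hθ).mul_const _).const_mul _) (((hexp hlam).mul_const _).const_mul _),
    integral_const_mul, integral_const_mul, integral_mul_const, integral_mul_const]

end Canonical

/-! ### Waiting-time and latency laws of the M/G/1 queue -/

/-- The law of the waiting time of job `k`. -/
noncomputable def waitLaw (lam : ℝ) (G : Measure ℝ) (k : ℕ) : Measure ℝ :=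
  (inputLaw lam G).map (backward k)

/-- The law of the latency of job `k`. -/
noncomputable def latencyLaw (lam : ℝ) (G : Measure ℝ) (k : ℕ) : Measure ℝ :=
  ((waitLaw lam G k).prod G).map fun p => p.1 + p.2

/-- The stationary law of the latency. -/
noncomputable def stationaryLatencyLaw (lam : ℝ) (G : Measure ℝ) : Measure ℝ :=
  ((inputLaw lam G).prod G).map fun p => stationaryWait p.1 + p.2

section Laws

variable {lam : ℝ} {G : Measure ℝ}

theorem latencyLaw_eq_map (hlam : 0 < lam) [IsProbabilityMeasure G] (k : ℕ) :
    latencyLaw lam G k = ((inputLaw lam G).prod G).map fun p => backward k p.1 + p.2 := by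
  have := isProbabilityMeasure_inputLaw (G := G) hlam
  have h : (waitLaw lam G k).prod G
      = ((inputLaw lam G).prod G).map (Prod.map (backward k) id) := by
    rw [← Measure.map_prod_map _ _ (measurable_backward k) measurable_id, Measure.map_id]
    rfl
  rw [latencyLaw, h, Measure.map_map (by fun_prop) (by fun_prop)]
  rfl

theorem latencyLaw_zero (hlam : 0 < lam) [IsProbabilityMeasure G] : latencyLaw lam G 0 = G := by
  have := isProbabilityMeasure_inputLaw (G := G) hlam
  rw [latencyLaw_eq_map hlam]
  have : (fun p : (ℕ → ℝ × ℝ) × ℝ => backward 0 p.1 + p.2) = Prod.snd := by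
    ext p
    simp [backward]
  rw [this, measurePreserving_snd.map_eq]

/-- The forward and backward recursions differ pathwise but agree in law: the wait in `latencyLaw
lam G k` uses `k` pairs, and the new service and interarrival times form an independent pair that
can be placed in front of them. -/
theorem waitLaw_succ (hlam : 0 < lam) [IsProbabilityMeasure G] (k : ℕ) :
    waitLaw lam G (k + 1)
      = ((latencyLaw lam G k).prod (expMeasure lam)).map fun p => max 0 (p.1 - p.2) := by
  have := isProbabilityMeasure_expMeasure hlam
  have := isProbabilityMeasure_inputLaw (G := G) hlam
  have h : (latencyLaw lam G k).prod (expMeasure lam)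
      = (((inputLaw lam G).prod G).prod (expMeasure lam)).map
        (Prod.map (fun p => backward k p.1 + p.2) id) := by
    rw [← Measure.map_prod_map _ _ (by fun_prop) measurable_id, Measure.map_id,
      latencyLaw_eq_map hlam]
  have h' : ((inputLaw lam G).prod G).prod (expMeasure lam)
      = ((G.prod (expMeasure lam)).prod (inputLaw lam G)).map
        fun p => ((p.2, p.1.1), p.1.2) := by
    have e := (measurePreserving_prodAssoc (inputLaw lam G) G (expMeasure lam)).symm.map_eq
    rw [← e, ← Measure.prod_swap, Measure.map_map (by fun_prop) measurable_swap]
    rfl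
  rw [h, h', Measure.map_map (by fun_prop) (by fun_prop),
    Measure.map_map (by fun_prop) (by fun_prop), waitLaw]
  conv_lhs => rw [inputLaw, ← map_seqCons_infinitePi]
  rw [Measure.map_map (by fun_prop) measurable_seqCons]
  rfl

theorem isProbabilityMeasure_stationaryLatencyLaw (hlam : 0 < lam) [IsProbabilityMeasure G] :
    IsProbabilityMeasure (stationaryLatencyLaw lam G) := by
  have := isProbabilityMeasure_inputLaw (G := G) hlam
  exact Measure.isProbabilityMeasure_map (by fun_prop)

theorem expect_map_add (hlam : 0 < lam) [IsProbabilityMeasure G] (hG : ∀ᵐ x ∂G, 0 ≤ x)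
    {f : (ℕ → ℝ × ℝ) → ℝ} (hf : Measurable f) (hf0 : ∀ u, 0 ≤ f u) :
    expect (((inputLaw lam G).prod G).map fun p => f p.1 + p.2) (fun x => x)
      = expect G (fun x => x) + ∫⁻ u, ENNReal.ofReal (f u) ∂(inputLaw lam G) := by
  have := isProbabilityMeasure_inputLaw (G := G) hlam
  rw [expect, lintegral_map (by fun_prop) (by fun_prop)]
  have e : ∀ᵐ p ∂((inputLaw lam G).prod G), ENNReal.ofReal (f p.1 + p.2)
      = ENNReal.ofReal (f p.1) + ENNReal.ofReal p.2 := by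
    filter_upwards [Measure.quasiMeasurePreserving_snd.ae hG] with p hp
    exact ENNReal.ofReal_add (hf0 _) hp
  rw [lintegral_congr_ae e, lintegral_add_left (by fun_prop), add_comm]
  congr 1
  · rw [← lintegral_map (f := fun x : ℝ => ENNReal.ofReal x) (by fun_prop) measurable_snd,
      measurePreserving_snd.map_eq]
    rfl
  · rw [← lintegral_map (f := fun u => ENNReal.ofReal (f u)) (by fun_prop) measurable_fst,
      measurePreserving_fst.map_eq]

theorem ae_bddAbove_backward_of_load (hlam : 0 < lam) [IsProbabilityMeasure G]
    (hG : ∀ᵐ x ∂G, 0 ≤ x) (hload : ENNReal.ofReal lam * expect G (fun x => x) < 1) :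
    ∀ᵐ u ∂(inputLaw lam G), BddAbove (Set.range fun k => backward k u) := by
  -- As `lam` is positive, an infinite mean would make the load infinite.
  have hfin : expect G (fun x => x) ≠ ∞ := by
    intro h
    rw [h, ENNReal.mul_top (by simpa using hlam)] at hload
    exact absurd hload (by simp)
  have hint := integrable_id_of_expect_ne_top hG hfin
  refine ae_bddAbove_backward hlam hint ?_
  have hm1 : expect G (fun x => x) = ENNReal.ofReal (∫ x, x ∂G) :=
    (ofReal_integral_eq_lintegral_ofReal hint hG).symm
  rwa [hm1, ← ENNReal.ofReal_mul hlam.le, ENNReal.ofReal_lt_one] at hload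

theorem lintegral_stationaryWait (hlam : 0 < lam) [IsProbabilityMeasure G]
    (hG : ∀ᵐ x ∂G, 0 ≤ x) (hload : ENNReal.ofReal lam * expect G (fun x => x) < 1) :
    ∫⁻ u, ENNReal.ofReal (stationaryWait u) ∂(inputLaw lam G)
      = ENNReal.ofReal lam * expect G (fun x => x ^ 2)
        / (2 * (1 - ENNReal.ofReal lam * expect G (fun x => x))) := by
  have := isProbabilityMeasure_inputLaw (G := G) hlam
  have hbdd := ae_bddAbove_backward_of_load hlam hG hload
  have hp : IsProbabilityMeasure ((inputLaw lam G).map stationaryWait) :=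
    Measure.isProbabilityMeasure_map (by fun_prop)
  have hpos : ∀ᵐ x ∂((inputLaw lam G).map stationaryWait), 0 ≤ x :=
    (ae_map_iff (by fun_prop) measurableSet_Ici).2 (Eventually.of_forall stationaryWait_nonneg)
  have hint (θ : ℝ) : ∫ x, Real.exp (-(θ * x)) ∂((inputLaw lam G).map stationaryWait)
      = ∫ u, Real.exp (-(θ * stationaryWait u)) ∂(inputLaw lam G) :=
    integral_map (by fun_prop) (by fun_prop)
  rw [← expect_of_laplace_identity hlam hpos hG hload
    (c := (∫ u, Real.exp (-(lam * stationaryWait u)) ∂(inputLaw lam G))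
          * ∫ x, Real.exp (-(lam * x)) ∂G), expect, lintegral_map (by fun_prop) (by fun_prop)]
  intro θ hθ
  rw [hint]
  exact laplace_stationaryWait hlam hG hbdd hθ

theorem expect_stationaryLatencyLaw (hlam : 0 < lam) [IsProbabilityMeasure G]
    (hG : ∀ᵐ x ∂G, 0 ≤ x) (hload : ENNReal.ofReal lam * expect G (fun x => x) < 1) :
    expect (stationaryLatencyLaw lam G) (fun x => x)
      = pollaczekKhinchine lam (expect G fun x => x) (expect G fun x => x ^ 2) := by
  rw [stationaryLatencyLaw, expect_map_add hlam hG measurable_stationaryWait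
    stationaryWait_nonneg, lintegral_stationaryWait hlam hG hload, pollaczekKhinchine]

theorem tendsto_expect_latencyLaw (hlam : 0 < lam) [IsProbabilityMeasure G]
    (hG : ∀ᵐ x ∂G, 0 ≤ x) (hload : ENNReal.ofReal lam * expect G (fun x => x) < 1) :
    Tendsto (fun k => expect (latencyLaw lam G k) fun x => x) atTop
      (𝓝 (pollaczekKhinchine lam (expect G fun x => x) (expect G fun x => x ^ 2))) := by
  have h (k : ℕ) : expect (latencyLaw lam G k) (fun x => x)
      = expect G (fun x => x) + ∫⁻ u, ENNReal.ofReal (backward k u) ∂(inputLaw lam G) := by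
    rw [latencyLaw_eq_map hlam]
    exact expect_map_add hlam hG (measurable_backward k) (backward_nonneg k)
  simp_rw [h]
  rw [pollaczekKhinchine, ← lintegral_stationaryWait hlam hG hload]
  refine tendsto_const_nhds.add (lintegral_tendsto_of_tendsto_of_monotone
    (fun k => by fun_prop) ?_ ?_)
  · exact Eventually.of_forall fun u i j hij =>
      ENNReal.ofReal_le_ofReal (monotone_backward u hij)
  · filter_upwards [ae_bddAbove_backward_of_load hlam hG hload] with u hu
    exact (ENNReal.continuous_ofReal.tendsto _).comp (tendsto_backward hu)

/-- Convergence in distribution depends only on the laws of the `T k`, so it can be read off from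
the almost sure convergence of `backward k` on the canonical space. -/
theorem isSteadyStateLaw_of_hasLaw (hlam : 0 < lam) [IsProbabilityMeasure G]
    (hG : ∀ᵐ x ∂G, 0 ≤ x) (hload : ENNReal.ofReal lam * expect G (fun x => x) < 1)
    {Ω : Type*} [MeasurableSpace Ω] {P : Measure Ω} [IsProbabilityMeasure P] {T : ℕ → Ω → ℝ}
    (hT : ∀ k, HasLaw (T k) (latencyLaw lam G k) P) {π : ProbabilityMeasure ℝ}
    (hπ : (π : Measure ℝ) = stationaryLatencyLaw lam G) : IsSteadyStateLaw P T π := by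
  have := isProbabilityMeasure_inputLaw (G := G) hlam
  have h := tendstoInDistribution_of_ae_tendsto (l := atTop) (μ' := (inputLaw lam G).prod G)
    (X := fun k p => backward k p.1 + p.2) (Z := fun p => stationaryWait p.1 + p.2)
    (fun k => by fun_prop) (by fun_prop) (by
      filter_upwards [Measure.quasiMeasurePreserving_fst.ae
        (ae_bddAbove_backward_of_load hlam hG hload)] with p hp
      exact (tendsto_backward hp).add_const _)
  refine ⟨fun k => (hT k).aemeasurable, aemeasurable_id, ?_⟩
  have hlim : (π : Measure ℝ).map id
      = ((inputLaw lam G).prod G).map fun p => stationaryWait p.1 + p.2 := by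
    rw [Measure.map_id, hπ, stationaryLatencyLaw]
  have hk (k : ℕ) : P.map (T k) = ((inputLaw lam G).prod G).map fun p => backward k p.1 + p.2 := by
    rw [(hT k).map_eq, latencyLaw_eq_map hlam]
  simpa only [hlim, hk] using h.tendsto

end Laws

/-! ### Latency laws from independent inputs -/

/-- Each function factors through its finitely many relevant coordinates, the others being filled
with 0; disjoint finite blocks of an independent family are independent. -/
theorem iIndepFun.indepFun_of_dependsOn {Ω ι : Type*} [MeasurableSpace Ω] {P : Measure Ω}
    {Z : ι → Ω → ℝ} (hind : iIndepFun Z P) (hZ : ∀ i, AEMeasurable (Z i) P)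
    {s t : Set ι} (hs : s.Finite) (ht : t.Finite) (hst : Disjoint s t) {f g : (ι → ℝ) → ℝ}
    (hf : Measurable f) (hg : Measurable g) (hfs : DependsOn f s) (hgt : DependsOn g t) :
    IndepFun (fun ω => f fun i => Z i ω) (fun ω => g fun i => Z i ω) P := by
  classical
  have extend {r : Set ι} (hr : r.Finite) {h : (ι → ℝ) → ℝ} (hm : Measurable h)
      (hd : DependsOn h r) : ∃ h' : (hr.toFinset → ℝ) → ℝ, Measurable h' ∧
        ∀ c : ι → ℝ, h' (fun i => c i) = h c := by
    refine ⟨fun y => h fun i => if hi : i ∈ hr.toFinset then y ⟨i, hi⟩ else 0, ?_, fun c => ?_⟩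
    · refine hm.comp (measurable_pi_iff.2 fun i => ?_)
      by_cases hi : i ∈ hr.toFinset
      · simpa only [hi, dif_pos] using measurable_pi_apply _
      · simp only [hi, dif_neg, not_false_eq_true, measurable_const]
    · refine hd fun i hi => ?_
      simp [hi]
  obtain ⟨f', hf', hff⟩ := extend hs hf hfs
  obtain ⟨g', hg', hgg⟩ := extend ht hg hgt
  have hd : Disjoint hs.toFinset ht.toFinset := by
    rwa [Set.Finite.disjoint_toFinset]
  have := (hind.indepFun_finset₀ hs.toFinset ht.toFinset hd hZ).comp hf' hg'
  convert this using 1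
  · ext ω
    exact (hff fun i => Z i ω).symm
  · ext ω
    exact (hgg fun i => Z i ω).symm

theorem SingleServer.latency_zero (t s : ℕ → ℝ) :
    SingleServer.latency (arrivalTime t) s 0 = s 0 := by
  simp [SingleServer.latency, SingleServer.departure]

/-- Lindley's recursion: the next job waits for the part of the current latency that outlasts the
interarrival time. -/
theorem SingleServer.latency_succ (t s : ℕ → ℝ) (k : ℕ) :
    SingleServer.latency (arrivalTime t) s (k + 1)
      = max 0 (SingleServer.latency (arrivalTime t) s k - t (k + 1)) + s (k + 1) := by
  have h : arrivalTime t (k + 1) = arrivalTime t k + t (k + 1) := Finset.sum_range_succ _ _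
  simp only [SingleServer.latency, SingleServer.departure, h]
  rcases le_total (arrivalTime t k + t (k + 1)) (departure (arrivalTime t) s k) with h1 | h1
  · rw [max_eq_right h1, max_eq_right (by linarith)]
    ring
  · rw [max_eq_left h1, max_eq_left (by linarith)]
    ring

/-- The latencies of a single-server queue whose interarrival and service times are functions of
independent inputs; `p i` is the rank at which input `i` is used. -/
theorem hasLaw_latency {Ω ι : Type*} [MeasurableSpace Ω] {P : Measure Ω}
    {lam : ℝ} (hlam : 0 < lam) {G : Measure ℝ} [IsProbabilityMeasure G]
    {Z : ι → Ω → ℝ} (hind : iIndepFun Z P) (hZ : ∀ i, AEMeasurable (Z i) P)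
    {p : ι → ℕ} (hp : ∀ m, {i | p i < m}.Finite) {t s : ℕ → (ι → ℝ) → ℝ}
    (ht : ∀ k, Measurable (t k)) (hs : ∀ k, Measurable (s k))
    (htd : ∀ k, DependsOn (t k) {i | p i = 2 * k})
    (hsd : ∀ k, DependsOn (s k) {i | p i = 2 * k + 1})
    (htl : ∀ k, HasLaw (fun ω => t k fun i => Z i ω) (expMeasure lam) P)
    (hsl : ∀ k, HasLaw (fun ω => s k fun i => Z i ω) G P) (k : ℕ) :
    HasLaw (fun ω => SingleServer.latency (arrivalTime fun j => t j fun i => Z i ω)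
      (fun j => s j fun i => Z i ω) k) (latencyLaw lam G k) P := by
  have := isProbabilityMeasure_expMeasure hlam
  have := (hsl 0).isProbabilityMeasure
  have hp' (m : ℕ) : {i | p i = m}.Finite :=
    (hp (m + 1)).subset fun i (hi : p i = m) => by simp [hi]
  have hdisj (m : ℕ) : Disjoint {i | p i < m} {i | p i = m} :=
    Set.disjoint_left.2 fun i (h1 : p i < m) (h2 : p i = m) => by omega
  let F : ℕ → (ι → ℝ) → ℝ := fun k c =>
    SingleServer.latency (arrivalTime fun j => t j c) (fun j => s j c) k
  let W : ℕ → (ι → ℝ) → ℝ := fun k c => max 0 (F k c - t (k + 1) c)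
  have hF0 : F 0 = s 0 := funext fun c => SingleServer.latency_zero _ _
  have hFs (k : ℕ) : F (k + 1) = fun c => W k c + s (k + 1) c :=
    funext fun c => SingleServer.latency_succ _ _ k
  have hFm (k : ℕ) : Measurable (F k) := by
    induction k with
    | zero => rw [hF0]; exact hs 0
    | succ k ih =>
      rw [hFs]
      exact (measurable_const.max (ih.sub (ht _))).add (hs _)
  have hWm (k : ℕ) : Measurable (W k) := measurable_const.max ((hFm k).sub (ht _))
  have hWd_of {k : ℕ} (h : DependsOn (F k) {i | p i < 2 * (k + 1)}) :
      DependsOn (W k) {i | p i < 2 * (k + 1) + 1} := by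
    intro c d hcd
    have h1 : F k c = F k d := h fun i (hi : p i < _) => hcd i (by
      show p i < _
      omega)
    have h2 : t (k + 1) c = t (k + 1) d := htd (k + 1) fun i (hi : p i = _) => hcd i (by
      show p i < _
      omega)
    simp only [W, h1, h2]
  -- Interarrival time `k` has rank `2 * k` and service time `k` rank `2 * k + 1`, so the latency of
  -- job `k` uses only ranks below `2 * (k + 1)`. The next interarrival time and then the next
  -- service time are each independent of everything used before.
  have hFd (k : ℕ) : DependsOn (F k) {i | p i < 2 * (k + 1)} := by
    induction k with
    | zero =>
      rw [hF0]
      exact fun c d hcd => hsd 0 fun i (hi : p i = _) => hcd i (by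
        show p i < _
        omega)
    | succ k ih =>
      intro c d hcd
      have h1 : W k c = W k d := hWd_of ih fun i (hi : p i < _) => hcd i (by
        show p i < _
        omega)
      have h2 : s (k + 1) c = s (k + 1) d := hsd (k + 1) fun i (hi : p i = _) => hcd i (by
        show p i < _
        omega)
      simp only [hFs, h1, h2]
  change HasLaw (fun ω => F k fun i => Z i ω) _ P
  induction k with
  | zero =>
    rw [hF0, latencyLaw_zero hlam]
    exact hsl 0
  | succ k ih =>
    have i1 := iIndepFun.indepFun_of_dependsOn hind hZ (hp _) (hp' _) (hdisj (2 * (k + 1)))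
      (hFm k) (ht (k + 1)) (hFd k) (htd (k + 1))
    have i2 := iIndepFun.indepFun_of_dependsOn hind hZ (hp _) (hp' _) (hdisj (2 * (k + 1) + 1))
      (hWm k) (hs (k + 1)) (hWd_of (hFd k)) (hsd (k + 1))
    have hW : HasLaw (fun ω => W k fun i => Z i ω) (waitLaw lam G (k + 1)) P := by
      have h1 := IndepFun.hasLaw_prod ih (htl (k + 1)) i1
      have h2 : HasLaw (fun q : ℝ × ℝ => max 0 (q.1 - q.2)) (waitLaw lam G (k + 1))
          ((latencyLaw lam G k).prod (expMeasure lam)) :=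
        ⟨by fun_prop, (waitLaw_succ hlam k).symm⟩
      exact h2.comp h1
    have h1 := IndepFun.hasLaw_prod hW (hsl (k + 1)) i2
    have h2 : HasLaw (fun q : ℝ × ℝ => q.1 + q.2) (latencyLaw lam G (k + 1))
        ((waitLaw lam G (k + 1)).prod G) := ⟨by fun_prop, rfl⟩
    rw [hFs]
    exact h2.comp h1

theorem IsMG1Input.hasLaw_latency {Ω : Type*} [MeasurableSpace Ω] {P : Measure Ω} {lam : ℝ}
    (hlam : 0 < lam) {G : Measure ℝ} [IsProbabilityMeasure G] {τ S : ℕ → Ω → ℝ}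
    (h : IsMG1Input lam G P τ S) (k : ℕ) :
    HasLaw (fun ω => SingleServer.latency (arrivalTime fun j => τ j ω) (fun j => S j ω) k)
      (latencyLaw lam G k) P := by
  refine _root_.hasLaw_latency (Z := fun c : ℕ ⊕ ℕ => Sum.elim τ S c) hlam h.indep ?_
    (p := Sum.elim (fun k => 2 * k) (fun k => 2 * k + 1)) ?_ (t := fun k c => c (Sum.inl k))
    (s := fun k c => c (Sum.inr k)) (by fun_prop) (by fun_prop) ?_ ?_ h.arrival_law
    h.service_law k
  · rintro (i | i)
    · exact (h.arrival_law i).aemeasurable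
    · exact (h.service_law i).aemeasurable
  · intro m
    refine (((Finset.range m).image Sum.inl ∪ (Finset.range m).image Sum.inr :
      Finset (ℕ ⊕ ℕ)).finite_toSet).subset ?_
    rintro (i | i) hi <;> simp at hi ⊢ <;> omega
  · exact fun k c d hcd => hcd _ rfl
  · exact fun k c d hcd => hcd _ rfl

/-! ### The fork-join system -/

namespace ForkJoin

variable {n : ℕ}

theorem completion_const (hn : 0 < n) (a f : ℝ) (x : Fin n → ℝ) :
    completion a (fun _ => f) x = max a f + ⨅ i, x i := by
  have : Nonempty (Fin n) := ⟨⟨0, hn⟩⟩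
  exact ((OrderIso.addLeft (max a f)).map_ciInf (Set.finite_range x).bddBelow).symm

theorem taskExit_const (hn : 0 < n) (a f : ℝ) (x : Fin n → ℝ) (i : Fin n) :
    taskExit a (fun _ => f) x i = max a f + ⨅ i, x i := by
  rw [taskExit, completion_const hn]
  refine min_eq_right ?_
  have := ciInf_le (Set.finite_range x).bddBelow i
  simp only [taskStart]
  linarith

/-- A server is released at the same instant whether its task is served or canceled, so equal free
times stay equal. Nothing is assumed about the arrival times or the service times. -/
theorem freeTime_const (hn : 0 < n) (a : ℕ → ℝ) (x : ℕ → Fin n → ℝ) (k : ℕ) :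
    ∃ f, freeTime a x k = fun _ => f := by
  induction k with
  | zero => exact ⟨0, rfl⟩
  | succ k ih =>
    obtain ⟨f, hf⟩ := ih
    refine ⟨max f (max (a k) f + ⨅ i, x k i), funext fun i => ?_⟩
    simp only [freeTime, hf, taskExit_const hn]

theorem cost_eq (hn : 0 < n) (a : ℕ → ℝ) (x : ℕ → Fin n → ℝ) (k : ℕ) (hx : ∀ i, 0 ≤ x k i) :
    cost a x k = n * ⨅ i, x k i := by
  obtain ⟨f, hf⟩ := freeTime_const hn a x k
  have h0 : 0 ≤ ⨅ i, x k i := Real.iInf_nonneg hx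
  simp [cost, serverTime, hf, taskExit_const hn, taskStart, h0]

/-- The sign of `a 0` matters because the servers are free from time 0 on, whereas the single server
imposes no such constraint on its first job. Nonnegative service times make the maximum with the
previous free time redundant. -/
theorem freeTime_succ (hn : 0 < n) {a : ℕ → ℝ} {x : ℕ → Fin n → ℝ} (ha : 0 ≤ a 0)
    (hx : ∀ k i, 0 ≤ x k i) (k : ℕ) :
    freeTime a x (k + 1) = fun _ => SingleServer.departure a (fun j => ⨅ i, x j i) k := by
  have h0 (k : ℕ) : 0 ≤ ⨅ i, x k i := Real.iInf_nonneg (hx k)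
  induction k with
  | zero =>
    funext i
    have h := taskExit_const hn (a 0) 0 (x 0) i
    rw [max_eq_left ha] at h
    simp only [freeTime, SingleServer.departure, h]
    exact max_eq_right (add_nonneg ha (h0 0))
  | succ k ih =>
    funext i
    rw [freeTime.eq_2, ih]
    simp only [taskExit_const hn, SingleServer.departure]
    refine max_eq_right ?_
    have := le_max_right (a (k + 1)) (SingleServer.departure a (fun j => ⨅ i, x j i) k)
    linarith [h0 (k + 1)]

theorem latency_eq (hn : 0 < n) {a : ℕ → ℝ} {x : ℕ → Fin n → ℝ} (ha : 0 ≤ a 0)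
    (hx : ∀ k i, 0 ≤ x k i) (k : ℕ) :
    latency a x k = SingleServer.latency a (fun j => ⨅ i, x j i) k := by
  cases k with
  | zero =>
    have h := completion_const hn (a 0) 0 (x 0)
    rw [max_eq_left ha] at h
    simp only [latency, SingleServer.latency, SingleServer.departure, freeTime, h]
  | succ k =>
    rw [latency, freeTime_succ hn ha hx, completion_const hn, SingleServer.latency,
      SingleServer.departure]

end ForkJoin

/-! ### The fork-join system with random input. -/

theorem measurable_iInf_fin {n : ℕ} : Measurable fun x : Fin n → ℝ => ⨅ i, x i :=
  Measurable.iInf fun i => measurable_pi_apply i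

theorem isProbabilityMeasure_minLaw (n : ℕ) (ν : Measure ℝ) [IsProbabilityMeasure ν] :
    IsProbabilityMeasure (minLaw n ν) :=
  Measure.isProbabilityMeasure_map measurable_iInf_fin.aemeasurable

theorem ae_minLaw_nonneg (n : ℕ) {ν : Measure ℝ} [IsProbabilityMeasure ν]
    (hν : ∀ᵐ x ∂ν, 0 < x) : ∀ᵐ x ∂(minLaw n ν), 0 ≤ x := by
  refine (ae_map_iff measurable_iInf_fin.aemeasurable measurableSet_Ici).2 ?_
  have h (i : Fin n) : ∀ᵐ x ∂(Measure.pi fun _ : Fin n => ν), 0 < x i :=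
    (measurePreserving_eval (fun _ : Fin n => ν) i).quasiMeasurePreserving.ae hν
  filter_upwards [ae_all_iff.2 h] with x hx
  exact Real.iInf_nonneg fun i => (hx i).le

namespace IsForkJoinInput

variable {Ω : Type*} [MeasurableSpace Ω] {n : ℕ} {lam : ℝ} {ν : Measure ℝ} {P : Measure Ω}
  {τ : ℕ → Ω → ℝ} {X : ℕ → Fin n → Ω → ℝ}

theorem hasLaw_iInf (h : IsForkJoinInput n lam ν P τ X) [IsProbabilityMeasure ν] (k : ℕ) :
    HasLaw (fun ω => ⨅ i, X k i ω) (minLaw n ν) P := by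
  have hinj : Function.Injective fun i : Fin n => (Sum.inr (k, i) : ℕ ⊕ (ℕ × Fin n)) := by
    intro i j hij
    simpa using hij
  have hind : iIndepFun (fun i => X k i) P :=
    iIndepFun.precomp (g := fun i : Fin n => (Sum.inr (k, i) : ℕ ⊕ (ℕ × Fin n))) hinj h.indep
  have h1 : HasLaw (fun ω i => X k i ω) (Measure.pi fun _ : Fin n => ν) P :=
    iIndepFun.hasLaw_pi (h.service_law k) hind
  have h2 : HasLaw (fun x : Fin n → ℝ => ⨅ i, x i) (minLaw n ν)
      (Measure.pi fun _ : Fin n => ν) := ⟨measurable_iInf_fin.aemeasurable, rfl⟩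
  exact h2.comp h1

theorem hasLaw_latency_iInf (hlam : 0 < lam) (h : IsForkJoinInput n lam ν P τ X)
    [IsProbabilityMeasure ν] (k : ℕ) :
    HasLaw (fun ω => SingleServer.latency (arrivalTime fun j => τ j ω)
      (fun j => ⨅ i, X j i ω) k) (latencyLaw lam (minLaw n ν) k) P := by
  have := isProbabilityMeasure_minLaw n ν
  refine hasLaw_latency (Z := fun c : ℕ ⊕ (ℕ × Fin n) => Sum.elim τ (fun p => X p.1 p.2) c) hlam
    h.indep ?_ (p := Sum.elim (fun k => 2 * k) (fun q => 2 * q.1 + 1)) ?_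
    (t := fun k c => c (Sum.inl k)) (s := fun k c => ⨅ i, c (Sum.inr (k, i))) (by fun_prop) ?_ ?_ ?_
    h.arrival_law h.hasLaw_iInf k
  · rintro (i | q)
    · exact (h.arrival_law i).aemeasurable
    · exact (h.service_law q.1 q.2).aemeasurable
  · intro m
    refine (((Finset.range m).image Sum.inl ∪
      (Finset.range m ×ˢ Finset.univ).image Sum.inr :
      Finset (ℕ ⊕ (ℕ × Fin n))).finite_toSet).subset ?_
    rintro (i | ⟨i, j⟩) hi <;> simp at hi ⊢ <;> omega
  · exact fun k => Measurable.iInf fun i => measurable_pi_apply _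
  · exact fun k c d hcd => hcd _ rfl
  · exact fun k c d hcd => iInf_congr fun i => hcd _ rfl

theorem ae_service_nonneg (h : IsForkJoinInput n lam ν P τ X) (hν : ∀ᵐ x ∂ν, 0 < x) :
    ∀ᵐ ω ∂P, ∀ k i, 0 ≤ X k i ω := by
  refine ae_all_iff.2 fun k => ae_all_iff.2 fun i => ?_
  have := hν
  rw [← (h.service_law k i).map_eq] at this
  exact (ae_of_ae_map (h.service_law k i).aemeasurable this).mono fun ω hω => le_of_lt hω

theorem hasLaw_latency (hn : 0 < n) (hlam : 0 < lam) (h : IsForkJoinInput n lam ν P τ X)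
    [IsProbabilityMeasure ν] (hν : ∀ᵐ x ∂ν, 0 < x) (k : ℕ) :
    HasLaw (fun ω => ForkJoin.latency (arrivalTime fun j => τ j ω) (fun j i => X j i ω) k)
      (latencyLaw lam (minLaw n ν) k) P := by
  refine (h.hasLaw_latency_iInf hlam k).congr ?_
  have hτ : ∀ᵐ ω ∂P, 0 < τ 0 ω := by
    have := ae_pos_expMeasure lam
    rw [← (h.arrival_law 0).map_eq] at this
    exact ae_of_ae_map (h.arrival_law 0).aemeasurable this
  filter_upwards [hτ, h.ae_service_nonneg hν] with ω h0 hx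
  exact ForkJoin.latency_eq hn (by simpa [arrivalTime] using h0.le) hx k

/-- The cost is almost surely `n` times the minimal service time of the job, so `A` may be
arbitrary: neither measurability nor independence from the service times plays a role. -/
theorem expect_cost (hn : 0 < n) (h : IsForkJoinInput n lam ν P τ X)
    [IsProbabilityMeasure ν] (hν : ∀ᵐ x ∂ν, 0 < x) (A : ℕ → Ω → ℝ) (k : ℕ) :
    expect P (fun ω => ForkJoin.cost (fun j => A j ω) (fun j i => X j i ω) k)
      = n * expect (minLaw n ν) fun x => x := by
  have e : ∀ᵐ ω ∂P, ENNReal.ofReal (ForkJoin.cost (fun j => A j ω) (fun j i => X j i ω) k)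
      = n * ENNReal.ofReal (⨅ i, X k i ω) := by
    filter_upwards [h.ae_service_nonneg hν] with ω hx
    rw [ForkJoin.cost_eq hn _ _ _ (hx k), ENNReal.ofReal_mul (by positivity),
      ENNReal.ofReal_natCast]
  rw [expect, lintegral_congr_ae e, lintegral_const_mul' _ _ (ENNReal.natCast_ne_top n)]
  congr 1
  exact (h.hasLaw_iInf k).lintegral_comp (f := fun x : ℝ => ENNReal.ofReal x) (by fun_prop)

end IsForkJoinInput

theorem mainTheorem3
    (n : ℕ) (hn : 0 < n) (lam : ℝ) (hlam : 0 < lam)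
    (ν : Measure ℝ) [IsProbabilityMeasure ν] (hν : ∀ᵐ x ∂ν, 0 < x)
    {Ω : Type*} [MeasurableSpace Ω] (P : Measure Ω) [IsProbabilityMeasure P]
    (τ : ℕ → Ω → ℝ) (X : ℕ → Fin n → Ω → ℝ) (hFJ : IsForkJoinInput n lam ν P τ X)
    {Ω' : Type*} [MeasurableSpace Ω'] (P' : Measure Ω') [IsProbabilityMeasure P']
    (τ' : ℕ → Ω' → ℝ) (S : ℕ → Ω' → ℝ) (hMG1 : IsMG1Input lam (minLaw n ν) P' τ' S)
    -- the latency of job `k` in the fork-join system and in the M/G/1 queue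
    (T : ℕ → Ω → ℝ) (hT : T = fun k ω =>
      ForkJoin.latency (arrivalTime fun j => τ j ω) (fun j i => X j i ω) k)
    (T' : ℕ → Ω' → ℝ) (hT' : T' = fun k ω =>
      SingleServer.latency (arrivalTime fun j => τ' j ω) (fun j => S j ω) k)
    -- the first two moments of `X_{1:n}`
    (m₁ m₂ : ℝ≥0∞) (hm₁ : m₁ = expect (minLaw n ν) fun x => x)
    (hm₂ : m₂ = expect (minLaw n ν) fun x => x ^ 2) :
    -- latency
    (ENNReal.ofReal lam * m₁ < 1 →
      (∃ π : ProbabilityMeasure ℝ,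
        IsSteadyStateLaw P T π ∧ IsSteadyStateLaw P' T' π ∧
        expect (π : Measure ℝ) (fun t => t) = pollaczekKhinchine lam m₁ m₂) ∧
      Tendsto (fun k => expect P (T k)) atTop (𝓝 (pollaczekKhinchine lam m₁ m₂)) ∧
      Tendsto (fun k => expect P' (T' k)) atTop (𝓝 (pollaczekKhinchine lam m₁ m₂))) ∧
    -- cost of every job, with Poisson arrivals and with any other sequence of arrival times
    (∀ k, expect P (fun ω =>
      ForkJoin.cost (arrivalTime fun j => τ j ω) (fun j i => X j i ω) k) = n * m₁) ∧
    (∀ (A : ℕ → Ω → ℝ) (k : ℕ),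
      expect P (fun ω => ForkJoin.cost (fun j => A j ω) (fun j i => X j i ω) k) = n * m₁) := by
  have := isProbabilityMeasure_minLaw n ν
  have hG := ae_minLaw_nonneg n hν
  have hTl (k : ℕ) : HasLaw (T k) (latencyLaw lam (minLaw n ν) k) P := by
    rw [hT]
    exact hFJ.hasLaw_latency hn hlam hν k
  have hTl' (k : ℕ) : HasLaw (T' k) (latencyLaw lam (minLaw n ν) k) P' := by
    rw [hT']
    exact hMG1.hasLaw_latency hlam k
  subst hm₁ hm₂
  refine ⟨fun hload => ⟨⟨⟨stationaryLatencyLaw lam (minLaw n ν),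
    isProbabilityMeasure_stationaryLatencyLaw hlam⟩,
    isSteadyStateLaw_of_hasLaw hlam hG hload hTl rfl,
    isSteadyStateLaw_of_hasLaw hlam hG hload hTl' rfl, expect_stationaryLatencyLaw hlam hG hload⟩,
    ?_, ?_⟩, fun k => hFJ.expect_cost hn hν _ k, fun A k => hFJ.expect_cost hn hν A k⟩
  · refine (tendsto_expect_latencyLaw hlam hG hload).congr fun k => ?_
    exact ((hTl k).lintegral_comp (f := fun x : ℝ => ENNReal.ofReal x) (by fun_prop)).symm
  · refine (tendsto_expect_latencyLaw hlam hG hload).congr fun k => ?_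
    exact ((hTl' k).lintegral_comp (f := fun x : ℝ => ENNReal.ofReal x) (by fun_prop)).symm
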